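/- A *central idempotent* in a symmetric monoidal category $\mathbf{C}$ is a morphism $u\colon U\to I$ such that $\rho_U\circ(U\otimes u)=\lambda_U\circ(u\otimes U)\colon U\otimes U\to U$ and this morphism is invertible. (Below, coherence isomorphisms are suppressed.) The *restriction* $\mathbf{C}|_u$ is the symmetric monoidal category whose objects are those of $\mathbf{C}$ and whose morphisms $A\to B$ are the morphisms $A\otimes U\to B$ of $\mathbf{C}$. The composite of $f\colon A\otimes U\to B$ and $g\colon B\otimes U\to D$ is $g\circ(f\otimes U)\circ(A\otimes U\otimes u)^{-1}$, and the identity of $A$ is $A\otimes u$. The tensor product of objects is that of $\mathbf{C}$, the tensor product of $f\colon A\otimes U\to B$ and $f'\colon A'\otimes U\to B'$ is $(f\otimes f')\circ(A\otimes\sigma_{A',U}\otimes U)\circ(A\otimes A'\otimes U\otimes u)^{-1}$, and the coherence isomorphisms are induced by those of $\mathbf{C}$. The restriction functor $\mathbf{C}|_{u\le 1}\colon\mathbf{C}\to\mathbf{C}|_u$, given by $A\mapsto A$ and $f\mapsto f\circ(A\otimes u)$, is strict symmetric monoidal, and so sends monoids to monoids. **Lemma.** For $i=1,2$ let $\mathbf{C}_i$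 be a symmetric monoidal category with an initial object $0$ satisfying $A\otimes 0\simeq 0$ for all objects $A$, and let $M_i$ be a monoid in $\mathbf{C}_i$. Then there are a symmetric monoidal category $\mathbf{C}$, a monoid $M$ in $\mathbf{C}$ and central idempotents $u_1,u_2$ in $\mathbf{C}$ such that for each $i\in\{1,2\}$ there is an equivalence of symmetric monoidal categories $F_i\colon\mathbf{C}|_{u_i}\to\mathbf{C}_i$ (a strong symmetric monoidal functor that is an equivalence of categories) for which the monoids $F_i(\mathbf{C}|_{u_i\le 1}(M))$ and $M_i$ in $\mathbf{C}_i$ are isomorphic. -/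

import Mathlib

open CategoryTheory MonoidalCategory Limits

universe v₁ v₂ u₁ u₂

namespace TensorTopology

universe v u

/-- A central idempotent in a symmetric monoidal category: a morphism `u : U ⟶ 𝟙_ C` such that the
two canonical morphisms `U ⊗ U ⟶ U` built from it coincide and are invertible. -/
structure CentralIdempotent (C : Type u) [Category.{v} C] [MonoidalCategory C]
    [SymmetricCategory C] where
  /-- the domain `U` -/
  dom : C
  /-- the morphism `u : U ⟶ 𝟙_ C` -/
  hom : dom ⟶ 𝟙_ C
  central : dom ◁ hom ≫ (ρ_ dom).hom = hom ▷ dom ≫ (λ_ dom).hom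
  isIso : IsIso (dom ◁ hom ≫ (ρ_ dom).hom)

variable {C : Type u} [Category.{v} C] [MonoidalCategory C] [SymmetricCategory C]

namespace CentralIdempotent

variable (u : CentralIdempotent C)

/-- The invertible morphism `U ⊗ U ⟶ U` induced by `u : U ⟶ 𝟙_ C`. -/
def mul : u.dom ⊗ u.dom ⟶ u.dom := u.dom ◁ u.hom ≫ (ρ_ u.dom).hom

instance : IsIso u.mul := u.isIso

/-- The inverse `U ⟶ U ⊗ U` of the morphism `U ⊗ U ⟶ U` induced by `u : U ⟶ 𝟙_ C`. -/
noncomputable def comul : u.dom ⟶ u.dom ⊗ u.dom := inv u.mul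

lemma comul_mul : u.comul ≫ u.mul = 𝟙 _ := by simp [comul]

lemma mul_comul : u.mul ≫ u.comul = 𝟙 _ := by simp [comul]

lemma mul_eq : u.mul = u.hom ▷ u.dom ≫ (λ_ u.dom).hom := u.central

lemma comul_whiskerLeft : u.comul ≫ u.dom ◁ u.hom = (ρ_ u.dom).inv := by
  have h := u.comul_mul
  rw [mul, ← Category.assoc] at h
  rw [← cancel_mono (ρ_ u.dom).hom, h, Iso.inv_hom_id]

lemma comul_whiskerRight : u.comul ≫ u.hom ▷ u.dom = (λ_ u.dom).inv := by
  have h := u.comul_mul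
  rw [mul_eq, ← Category.assoc] at h
  rw [← cancel_mono (λ_ u.dom).hom, h, Iso.inv_hom_id]

lemma mul_whiskerRight :
    u.mul ▷ u.dom = (α_ u.dom u.dom u.dom).hom ≫ u.dom ◁ u.mul := by
  conv_rhs => rw [mul_eq]
  rw [mul]
  simp

lemma comul_assoc : u.comul ≫ u.comul ▷ u.dom ≫ (α_ _ _ _).hom = u.comul ≫ u.dom ◁ u.comul := by
  congr 1
  rw [← cancel_mono (u.dom ◁ u.mul), Category.assoc, ← mul_whiskerRight,
    ← comp_whiskerRight, ← whiskerLeft_comp, comul_mul]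
  simp

lemma braiding_eq : (β_ u.dom u.dom).hom = 𝟙 _ := by
  rw [← cancel_mono u.mul, Category.id_comp]
  have : (β_ u.dom u.dom).hom ≫ u.dom ◁ u.hom ≫ (ρ_ u.dom).hom =
      u.hom ▷ u.dom ≫ (λ_ u.dom).hom := by
    rw [← BraidedCategory.braiding_naturality_left_assoc, braiding_rightUnitor]
  rw [mul, this, u.central]

lemma tensorμ_eq : tensorμ u.dom u.dom u.dom u.dom = 𝟙 _ := by
  simp [tensorμ, braiding_eq]

/-- The composite of `f : A ⊗ U ⟶ B` and `g : B ⊗ U ⟶ D`, namely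
`A ⊗ U ⟶ A ⊗ U ⊗ U ⟶ B ⊗ U ⟶ D`, where the first morphism is the inverse of `A ⊗ U ⊗ u`
(see `whiskerLeft_comul_comp`). -/
noncomputable def compHom {A B D : C} (f : A ⊗ u.dom ⟶ B) (g : B ⊗ u.dom ⟶ D) : A ⊗ u.dom ⟶ D :=
  A ◁ u.comul ≫ (α_ A u.dom u.dom).inv ≫ f ▷ u.dom ≫ g

/-- A morphism `f : A ⟶ B` of `C` induces `A ⊗ U ⟶ A ⟶ B`. -/
def liftHom {A B : C} (f : A ⟶ B) : A ⊗ u.dom ⟶ B :=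
  A ◁ u.hom ≫ (ρ_ A).hom ≫ f

/-- The tensor product of `f : A ⊗ U ⟶ B` and `f' : A' ⊗ U ⟶ B'`, namely
`A ⊗ A' ⊗ U ⟶ A ⊗ A' ⊗ U ⊗ U ⟶ A ⊗ U ⊗ A' ⊗ U ⟶ B ⊗ B'`, where the first morphism is the inverse
of `A ⊗ A' ⊗ U ⊗ u` and the second one is the symmetry of `A'` and `U`. -/
noncomputable def tensHom {A B A' B' : C} (f : A ⊗ u.dom ⟶ B) (f' : A' ⊗ u.dom ⟶ B') :
    (A ⊗ A') ⊗ u.dom ⟶ B ⊗ B' :=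
  (A ⊗ A') ◁ u.comul ≫ tensorμ A A' u.dom u.dom ≫ (f ⊗ₘ f')

/-- The inverse of `A ⊗ U ⊗ u`, up to coherence. -/
lemma whiskerLeft_comul_comp (A : C) :
    A ◁ u.comul ≫ (α_ A u.dom u.dom).inv ≫ (A ⊗ u.dom) ◁ u.hom ≫ (ρ_ (A ⊗ u.dom)).hom = 𝟙 _ := by
  have : (α_ A u.dom u.dom).inv ≫ (A ⊗ u.dom) ◁ u.hom ≫ (ρ_ (A ⊗ u.dom)).hom = A ◁ u.mul := by
    simp [mul]
  rw [this, ← whiskerLeft_comp, comul_mul, whiskerLeft_id]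

lemma comp_whiskerLeft_comul (A : C) :
    ((A ⊗ u.dom) ◁ u.hom ≫ (ρ_ (A ⊗ u.dom)).hom) ≫ A ◁ u.comul ≫ (α_ A u.dom u.dom).inv = 𝟙 _ := by
  have : (A ⊗ u.dom) ◁ u.hom ≫ (ρ_ (A ⊗ u.dom)).hom = (α_ A u.dom u.dom).hom ≫ A ◁ u.mul := by
    simp [mul]
  rw [this, Category.assoc, ← whiskerLeft_comp_assoc, mul_comul]
  simp

lemma whiskerLeft_comul_comp' (A : C) :
    A ◁ u.comul ≫ (α_ A u.dom u.dom).inv ≫ (A ◁ u.hom) ▷ u.dom ≫ (ρ_ A).hom ▷ u.dom = 𝟙 _ := by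
  have : (α_ A u.dom u.dom).inv ≫ (A ◁ u.hom) ▷ u.dom ≫ (ρ_ A).hom ▷ u.dom = A ◁ u.mul := by
    rw [u.mul_eq]
    simp
  rw [this, ← whiskerLeft_comp, comul_mul, whiskerLeft_id]

section

variable {A B D E : C}

lemma compHom_lift (f : A ⊗ u.dom ⟶ B) (g : B ⟶ D) : u.compHom f (u.liftHom g) = f ≫ g := by
  rw [compHom, liftHom, ← whisker_exchange_assoc, rightUnitor_naturality_assoc,
    reassoc_of% u.whiskerLeft_comul_comp]

lemma lift_compHom (f : A ⟶ B) (g : B ⊗ u.dom ⟶ D) :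
    u.compHom (u.liftHom f) g = f ▷ u.dom ≫ g := by
  rw [compHom, liftHom, comp_whiskerRight, comp_whiskerRight, Category.assoc, Category.assoc,
    reassoc_of% u.whiskerLeft_comul_comp']

lemma id_compHom (f : A ⊗ u.dom ⟶ B) : u.compHom (u.liftHom (𝟙 A)) f = f := by
  rw [lift_compHom, id_whiskerRight, Category.id_comp]

lemma compHom_id (f : A ⊗ u.dom ⟶ B) : u.compHom f (u.liftHom (𝟙 B)) = f := by
  rw [compHom_lift, Category.comp_id]

lemma lift_comp (f : A ⟶ B) (g : B ⟶ D) :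
    u.liftHom (f ≫ g) = u.compHom (u.liftHom f) (u.liftHom g) := by
  rw [compHom_lift]; simp [liftHom]

lemma compHom_assoc (f : A ⊗ u.dom ⟶ B) (g : B ⊗ u.dom ⟶ D) (h : D ⊗ u.dom ⟶ E) :
    u.compHom (u.compHom f g) h = u.compHom f (u.compHom g h) := by
  have h1 : A ◁ u.comul ≫ (α_ A u.dom u.dom).inv ≫ (A ◁ u.comul) ▷ u.dom ≫
      (α_ A u.dom u.dom).inv ▷ u.dom =
      A ◁ u.comul ≫ (α_ A u.dom u.dom).inv ≫ (A ⊗ u.dom) ◁ u.comul ≫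
        (α_ (A ⊗ u.dom) u.dom u.dom).inv := by
    trans A ◁ (u.comul ≫ u.comul ▷ u.dom ≫ (α_ _ _ _).hom) ≫ (α_ A u.dom _).inv ≫
      (α_ (A ⊗ u.dom) u.dom u.dom).inv
    · monoidal
    · rw [u.comul_assoc]
      monoidal
  simp only [compHom, comp_whiskerRight, Category.assoc]
  rw [reassoc_of% h1, ← whisker_exchange_assoc, associator_inv_naturality_left_assoc]

end

section

variable {A B D A' B' D' A'' B'' : C}

lemma lift_tensHom_lift (f : A ⟶ B) (g : A' ⟶ B') :
    u.tensHom (u.liftHom f) (u.liftHom g) = u.liftHom (f ⊗ₘ g) := by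
  have h1 : u.comul ≫ (u.hom ⊗ₘ u.hom) = u.hom ≫ (λ_ (𝟙_ C)).inv := by
    rw [MonoidalCategory.tensorHom_def, reassoc_of% u.comul_whiskerRight]
    simp
  simp only [tensHom, liftHom, ← tensorHom_comp_tensorHom]
  rw [← tensorμ_natural_right_assoc, ← whiskerLeft_comp_assoc, h1, whiskerLeft_comp_assoc,
    ← tensor_right_unitality_assoc]

lemma tensHom_comp (f : A ⊗ u.dom ⟶ B) (f' : A' ⊗ u.dom ⟶ B')
    (g : B ⊗ u.dom ⟶ D) (g' : B' ⊗ u.dom ⟶ D') :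
    u.compHom (u.tensHom f f') (u.tensHom g g') =
      u.tensHom (u.compHom f g) (u.compHom f' g') := by
  have h1 : (α_ (A ⊗ A') u.dom u.dom).inv ≫ ((A ⊗ A') ◁ u.comul) ▷ u.dom ≫
      ((A ⊗ A') ⊗ (u.dom ⊗ u.dom)) ◁ u.comul =
      (A ⊗ A') ◁ (u.comul ⊗ₘ u.comul) ≫ (α_ (A ⊗ A') (u.dom ⊗ u.dom) (u.dom ⊗ u.dom)).inv := by
    rw [MonoidalCategory.tensorHom_def]
    monoidal
  have h2 : (α_ (A ⊗ A') (u.dom ⊗ u.dom) (u.dom ⊗ u.dom)).inv ≫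
      tensorμ A A' u.dom u.dom ▷ (u.dom ⊗ u.dom) ≫
        tensorμ (A ⊗ u.dom) (A' ⊗ u.dom) u.dom u.dom =
      tensorμ A A' (u.dom ⊗ u.dom) (u.dom ⊗ u.dom) ≫
        ((α_ A u.dom u.dom).inv ⊗ₘ (α_ A' u.dom u.dom).inv) := by
    have := tensor_associativity A A' u.dom u.dom u.dom u.dom
    rw [tensorμ_eq, whiskerLeft_id, Category.id_comp] at this
    rw [Iso.inv_comp_eq, ← reassoc_of% this, tensorHom_comp_tensorHom]
    simp
  simp only [compHom, tensHom, comp_whiskerRight, Category.assoc, ← tensorHom_comp_tensorHom]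
  rw [← whisker_exchange_assoc (f ⊗ₘ f'), tensorμ_natural_left_assoc,
    ← whisker_exchange_assoc (tensorμ A A' u.dom u.dom), reassoc_of% h1, reassoc_of% h2,
    tensorμ_natural_right_assoc]

lemma tensHom_associator (f : A ⊗ u.dom ⟶ B) (f' : A' ⊗ u.dom ⟶ B') (f'' : A'' ⊗ u.dom ⟶ B'') :
    u.tensHom (u.tensHom f f') f'' ≫ (α_ B B' B'').hom =
      (α_ A A' A'').hom ▷ u.dom ≫ u.tensHom f (u.tensHom f' f'') := by
  have h1 : u.tensHom (u.tensHom f f') f'' =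
      ((A ⊗ A') ⊗ A'') ◁ (u.comul ≫ u.comul ▷ u.dom) ≫
        tensorμ (A ⊗ A') A'' (u.dom ⊗ u.dom) u.dom ≫
        tensorμ A A' u.dom u.dom ▷ (A'' ⊗ u.dom) ≫ ((f ⊗ₘ f') ⊗ₘ f'') := by
    have := tensorμ_natural_right (A ⊗ A') A'' u.comul (𝟙 u.dom)
    simp only [tensorHom_id, whiskerLeft_id] at this
    rw [whiskerLeft_comp_assoc, reassoc_of% this]
    simp only [tensHom, MonoidalCategory.tensorHom_def, comp_whiskerRight, Category.assoc]
  have h2 : u.tensHom f (u.tensHom f' f'') =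
      (A ⊗ A' ⊗ A'') ◁ (u.comul ≫ u.dom ◁ u.comul) ≫
        tensorμ A (A' ⊗ A'') u.dom (u.dom ⊗ u.dom) ≫
        (A ⊗ u.dom) ◁ tensorμ A' A'' u.dom u.dom ≫ (f ⊗ₘ (f' ⊗ₘ f'')) := by
    have := tensorμ_natural_right A (A' ⊗ A'') (𝟙 u.dom) u.comul
    simp only [id_tensorHom, whiskerLeft_id] at this
    rw [whiskerLeft_comp_assoc, reassoc_of% this]
    simp only [tensHom, MonoidalCategory.tensorHom_def', whiskerLeft_comp, Category.assoc]
  rw [h1, h2, ← u.comul_assoc]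
  simp only [Category.assoc, associator_naturality, associator_monoidal_assoc]
  rw [← whisker_exchange_assoc, MonoidalCategory.tensorHom_def']
  simp only [whiskerLeft_comp, Category.assoc]

lemma tensHom_leftUnitor (f : A ⊗ u.dom ⟶ B) :
    u.tensHom (u.liftHom (𝟙 (𝟙_ C))) f ≫ (λ_ B).hom = (λ_ A).hom ▷ u.dom ≫ f := by
  have h := tensorμ_natural_right (𝟙_ C) A u.hom (𝟙 u.dom)
  simp only [tensorHom_id, whiskerLeft_id] at h
  have h2 : u.tensHom (u.liftHom (𝟙 (𝟙_ C))) f = (𝟙_ C ⊗ A) ◁ u.comul ≫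
      tensorμ (𝟙_ C) A u.dom u.dom ≫ ((𝟙_ C) ◁ u.hom) ▷ (A ⊗ u.dom) ≫
      (ρ_ (𝟙_ C)).hom ▷ (A ⊗ u.dom) ≫ 𝟙_ C ◁ f := by
    simp only [tensHom, liftHom, MonoidalCategory.tensorHom_def, comp_whiskerRight, Category.assoc,
      id_whiskerRight, Category.id_comp]
  rw [h2]
  simp only [Category.assoc, leftUnitor_naturality]
  rw [← reassoc_of% h, ← whiskerLeft_comp_assoc, u.comul_whiskerRight, ← unitors_equal,
    ← leftUnitor_monoidal_assoc]
  simp [MonoidalCategory.tensorHom_def']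

lemma tensHom_rightUnitor (f : A ⊗ u.dom ⟶ B) :
    u.tensHom f (u.liftHom (𝟙 (𝟙_ C))) ≫ (ρ_ B).hom = (ρ_ A).hom ▷ u.dom ≫ f := by
  have h := tensorμ_natural_right A (𝟙_ C) (𝟙 u.dom) u.hom
  simp only [id_tensorHom, whiskerLeft_id] at h
  have h2 : u.tensHom f (u.liftHom (𝟙 (𝟙_ C))) = (A ⊗ 𝟙_ C) ◁ u.comul ≫
      tensorμ A (𝟙_ C) u.dom u.dom ≫ (A ⊗ u.dom) ◁ ((𝟙_ C) ◁ u.hom) ≫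
      (A ⊗ u.dom) ◁ (ρ_ (𝟙_ C)).hom ≫ f ▷ 𝟙_ C := by
    simp only [tensHom, liftHom, MonoidalCategory.tensorHom_def', whiskerLeft_comp, Category.assoc,
      whiskerLeft_id, Category.id_comp]
  rw [h2]
  simp only [Category.assoc, rightUnitor_naturality]
  rw [← reassoc_of% h, ← whiskerLeft_comp_assoc, u.comul_whiskerLeft, ← unitors_equal,
    ← rightUnitor_monoidal_assoc]
  simp [MonoidalCategory.tensorHom_def]

lemma tensHom_braiding (f : A ⊗ u.dom ⟶ B) (f' : A' ⊗ u.dom ⟶ B') :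
    u.tensHom f f' ≫ (β_ B B').hom = (β_ A A').hom ▷ u.dom ≫ u.tensHom f' f := by
  have h : tensorμ A A' u.dom u.dom ≫ (β_ (A ⊗ u.dom) (A' ⊗ u.dom)).hom =
      ((β_ A A').hom ⊗ₘ (β_ u.dom u.dom).hom) ≫ tensorμ A' A u.dom u.dom := by
    simp [tensorμ, SymmetricCategory.braiding_swap_eq_inv_braiding A' u.dom,
      MonoidalCategory.tensorHom_def]
  simp only [tensHom, Category.assoc, BraidedCategory.braiding_naturality]
  rw [reassoc_of% h, braiding_eq, tensorHom_id, whisker_exchange_assoc]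

end

end CentralIdempotent

/-- The restriction of `C` to a central idempotent `u`: its objects are those of `C`. -/
structure Restriction (u : CentralIdempotent C) where
  /-- the underlying object of `C` -/
  as : C

namespace Restriction

variable {u : CentralIdempotent C}

/-- Morphisms `A ⟶ B` in the restriction to `u : U ⟶ 𝟙_ C` are morphisms `A ⊗ U ⟶ B` in `C`. -/
@[ext]
structure Hom (A B : Restriction u) where
  /-- the underlying morphism of `C` -/
  hom : A.as ⊗ u.dom ⟶ B.as

/-- The identity of `A` is `A ⊗ u`, up to coherence. -/
noncomputable instance : Category (Restriction u) where
  Hom A B := Hom A B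
  id A := ⟨u.liftHom (𝟙 A.as)⟩
  comp f g := ⟨u.compHom f.hom g.hom⟩
  id_comp f := Hom.ext (u.id_compHom f.hom)
  comp_id f := Hom.ext (u.compHom_id f.hom)
  assoc f g h := Hom.ext (u.compHom_assoc f.hom g.hom h.hom)

/-- The functor from `C` to its restriction to `u`, that is, the restriction functor for `u ≤ 1`:
it is the identity on objects and sends `f : A ⟶ B` to `A ⊗ U ⟶ A ⟶ B`. -/
noncomputable def functor (u : CentralIdempotent C) : C ⥤ Restriction u where
  obj A := ⟨A⟩
  map f := ⟨u.liftHom f⟩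
  map_id _ := rfl
  map_comp f g := Hom.ext (u.lift_comp f g)

/-- The tensor product of objects and the coherence isomorphisms are those of `C`. -/
noncomputable instance : MonoidalCategoryStruct (Restriction u) where
  tensorObj A B := ⟨A.as ⊗ B.as⟩
  tensorHom f g := ⟨u.tensHom f.hom g.hom⟩
  whiskerLeft A _ _ f := ⟨u.tensHom (u.liftHom (𝟙 A.as)) f.hom⟩
  whiskerRight f A := ⟨u.tensHom f.hom (u.liftHom (𝟙 A.as))⟩
  tensorUnit := ⟨𝟙_ C⟩
  associator A B D := (functor u).mapIso (α_ A.as B.as D.as)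
  leftUnitor A := (functor u).mapIso (λ_ A.as)
  rightUnitor A := (functor u).mapIso (ρ_ A.as)

lemma comp_lift_eq {A A' B D : Restriction u} {f : A ⟶ B} {g : B.as ⟶ D.as} {h : A.as ⟶ A'.as}
    {k : A' ⟶ D} (e : f.hom ≫ g = h ▷ u.dom ≫ k.hom) :
    f ≫ (⟨u.liftHom g⟩ : Hom B D) = (⟨u.liftHom h⟩ : Hom A A') ≫ k :=
  Hom.ext ((u.compHom_lift f.hom g).trans (e.trans (u.lift_compHom h k.hom).symm))

lemma map_tensorHom_map {A B A' B' : C} (f : A ⟶ B) (g : A' ⟶ B') :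
    (functor u).map f ⊗ₘ (functor u).map g = (functor u).map (f ⊗ₘ g) :=
  Hom.ext (u.lift_tensHom_lift f g)

lemma map_whiskerRight {A B : C} (f : A ⟶ B) (D : C) :
    (functor u).map f ▷ (functor u).obj D = (functor u).map (f ▷ D) := by
  rw [← tensorHom_id]
  exact map_tensorHom_map f (𝟙 D)

lemma whiskerLeft_map {A B : C} (D : C) (f : A ⟶ B) :
    (functor u).obj D ◁ (functor u).map f = (functor u).map (D ◁ f) := by
  rw [← id_tensorHom]
  exact map_tensorHom_map (𝟙 D) f

noncomputable instance : MonoidalCategory (Restriction u) :=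
  MonoidalCategory.ofTensorHom
    (id_tensorHom_id := fun A B =>
      (map_tensorHom_map (𝟙 A.as) (𝟙 B.as)).trans
        ((congrArg (functor u).map (id_tensorHom_id A.as B.as)).trans ((functor u).map_id _)))
    (id_tensorHom := fun _ _ _ _ => rfl)
    (tensorHom_id := fun _ _ => rfl)
    (tensorHom_comp_tensorHom := fun f₁ f₂ g₁ g₂ =>
      Hom.ext (u.tensHom_comp f₁.hom f₂.hom g₁.hom g₂.hom))
    (associator_naturality := fun f₁ f₂ f₃ =>
      comp_lift_eq (u.tensHom_associator f₁.hom f₂.hom f₃.hom))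
    (leftUnitor_naturality := fun f => comp_lift_eq (u.tensHom_leftUnitor f.hom))
    (rightUnitor_naturality := fun f => comp_lift_eq (u.tensHom_rightUnitor f.hom))
    (pentagon := fun W X Y Z => by
      have := congrArg (functor u).map (MonoidalCategory.pentagon W.as X.as Y.as Z.as)
      simp only [Functor.map_comp, ← map_whiskerRight, ← whiskerLeft_map] at this
      exact this)
    (triangle := fun X Y => by
      have := congrArg (functor u).map (MonoidalCategory.triangle X.as Y.as)
      simp only [Functor.map_comp, ← map_whiskerRight, ← whiskerLeft_map] at this
      exact this)

noncomputable instance : SymmetricCategory (Restriction u) where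
  braiding A B := (functor u).mapIso (β_ A.as B.as)
  braiding_naturality_right X _ _ f := comp_lift_eq (u.tensHom_braiding (u.liftHom (𝟙 X.as)) f.hom)
  braiding_naturality_left f X := comp_lift_eq (u.tensHom_braiding f.hom (u.liftHom (𝟙 X.as)))
  hexagon_forward X Y Z := by
    have := congrArg (functor u).map (BraidedCategory.hexagon_forward X.as Y.as Z.as)
    simp only [Functor.map_comp, ← map_whiskerRight, ← whiskerLeft_map] at this
    exact this
  hexagon_reverse X Y Z := by
    have := congrArg (functor u).map (BraidedCategory.hexagon_reverse X.as Y.as Z.as)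
    simp only [Functor.map_comp, ← map_whiskerRight, ← whiskerLeft_map] at this
    exact this
  symmetry X Y :=
    (((functor u).map_comp _ _).symm.trans
      (congrArg (functor u).map (SymmetricCategory.symmetry X.as Y.as))).trans ((functor u).map_id _)

lemma eq_id_comp_id_comp {A B : Restriction u} {a : A ⟶ A} (ha : a = 𝟙 A) (g : A ⟶ B) :
    g = a ≫ 𝟙 A ≫ g := by
  rw [ha, Category.id_comp, Category.id_comp]

lemma eq_comp_id_comp_id {A B : Restriction u} {b : B ⟶ B} (hb : b = 𝟙 B) (g : A ⟶ B) :
    g = g ≫ b ≫ 𝟙 B := by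
  rw [hb, Category.comp_id, Category.comp_id]

/-- The restriction functor is strict monoidal: its structure morphisms are identities. -/
noncomputable instance : (functor u).Monoidal :=
  Functor.CoreMonoidal.toMonoidal
    { εIso := Iso.refl (𝟙_ (Restriction u))
      μIso := fun A B => Iso.refl ((functor u).obj A ⊗ (functor u).obj B)
      μIso_hom_natural_left := fun f X =>
        (Category.comp_id _).trans ((map_whiskerRight f X).trans (Category.id_comp _).symm)
      μIso_hom_natural_right := fun X f =>
        (Category.comp_id _).trans ((whiskerLeft_map X f).trans (Category.id_comp _).symm)
      associativity := fun _ _ _ =>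
        (eq_id_comp_id_comp (id_whiskerRight _ _) _).symm.trans
          (eq_comp_id_comp_id (whiskerLeft_id _ _) _)
      left_unitality := fun _ => eq_id_comp_id_comp (id_whiskerRight _ _) _
      right_unitality := fun _ => eq_id_comp_id_comp (whiskerLeft_id _ _) _ }

/-- The restriction functor is a functor of symmetric monoidal categories. -/
noncomputable instance : (functor u).Braided where
  braided _ _ := (Category.id_comp _).trans (Category.comp_id _).symm

end Restriction

end TensorTopology

/-! Take `C = C₁ × C₂` with the componentwise structure, `M = (M₁, M₂)`, `w₁ = (𝟙 I, 0 ⟶ I)` and `w₂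
= (0 ⟶ I, 𝟙 I)`. Since `A ⊗ 0` is initial, `0 ⟶ I` is a central idempotent, and restricting along it
collapses every hom-set: a morphism `A ⟶ B` becomes one `A ⊗ 0 ⟶ B`, of which there is exactly one.
Hence restricting to `w₁` erases the second factor and leaves the first intact. The comparison
functor comes from a universal property. A braided functor `P` that inverts `u` factors through the
restriction to `u` by sending `f : A ⊗ U ⟶ B` to `P(A ⊗ u)⁻¹ ≫ P f` (`Restriction.desc`), and the
factorization is an equivalence as soon as `P` is essentially surjective and bijective on morphisms
`A ⊗ U ⟶ B` (`Restriction.desc_isEquivalence`). The projections satisfy this for `w₁` and `w₂`, and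
they send `M` to `M₁` and `M₂`. -/

namespace CategoryTheory.Prod

/-! ### Products of symmetric monoidal categories and their projections -/

open scoped CategoryTheory.MonObj

variable (C : Type u₁) [Category.{v₁} C] [MonoidalCategory C] [SymmetricCategory C]
  (D : Type u₂) [Category.{v₂} D] [MonoidalCategory D] [SymmetricCategory D]

/-- The product of two symmetric monoidal categories is symmetric monoidal, with braiding given
componentwise. -/
instance symmetricCategory : SymmetricCategory (C × D) where
  braiding X Y := (β_ X.1 Y.1).prod (β_ X.2 Y.2)
  braiding_naturality_right _ _ _ _ := Prod.ext
    (BraidedCategory.braiding_naturality_right _ _) (BraidedCategory.braiding_naturality_right _ _)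
  braiding_naturality_left _ _ := Prod.ext
    (BraidedCategory.braiding_naturality_left _ _) (BraidedCategory.braiding_naturality_left _ _)
  hexagon_forward _ _ _ := Prod.ext
    (BraidedCategory.hexagon_forward _ _ _) (BraidedCategory.hexagon_forward _ _ _)
  hexagon_reverse _ _ _ := Prod.ext
    (BraidedCategory.hexagon_reverse _ _ _) (BraidedCategory.hexagon_reverse _ _ _)
  symmetry _ _ := Prod.ext (SymmetricCategory.symmetry _ _) (SymmetricCategory.symmetry _ _)

/-- The first projection is a strict monoidal functor. -/
instance fstMonoidal : (Prod.fst C D).Monoidal :=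
  Functor.CoreMonoidal.toMonoidal
    { εIso := Iso.refl (𝟙_ C)
      μIso := fun X Y => Iso.refl (X.1 ⊗ Y.1)
      μIso_hom_natural_left := fun _ _ => (Category.comp_id _).trans (Category.id_comp _).symm
      μIso_hom_natural_right := fun _ _ => (Category.comp_id _).trans (Category.id_comp _).symm
      associativity := fun X Y Z => by
        change 𝟙 (X.1 ⊗ Y.1) ▷ Z.1 ≫ 𝟙 _ ≫ (α_ X.1 Y.1 Z.1).hom =
          (α_ X.1 Y.1 Z.1).hom ≫ X.1 ◁ 𝟙 (Y.1 ⊗ Z.1) ≫ 𝟙 _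
        simp
      left_unitality := fun X => by
        change (λ_ X.1).hom = 𝟙 (𝟙_ C) ▷ X.1 ≫ 𝟙 _ ≫ (λ_ X.1).hom
        simp
      right_unitality := fun X => by
        change (ρ_ X.1).hom = X.1 ◁ 𝟙 (𝟙_ C) ≫ 𝟙 _ ≫ (ρ_ X.1).hom
        simp }

instance fstBraided : (Prod.fst C D).Braided where
  braided _ _ := (Category.id_comp _).trans (Category.comp_id _).symm

/-- The second projection is a strict monoidal functor. -/
instance sndMonoidal : (Prod.snd C D).Monoidal :=
  Functor.CoreMonoidal.toMonoidal
    { εIso := Iso.refl (𝟙_ D)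
      μIso := fun X Y => Iso.refl (X.2 ⊗ Y.2)
      μIso_hom_natural_left := fun _ _ => (Category.comp_id _).trans (Category.id_comp _).symm
      μIso_hom_natural_right := fun _ _ => (Category.comp_id _).trans (Category.id_comp _).symm
      associativity := fun X Y Z => by
        change 𝟙 (X.2 ⊗ Y.2) ▷ Z.2 ≫ 𝟙 _ ≫ (α_ X.2 Y.2 Z.2).hom =
          (α_ X.2 Y.2 Z.2).hom ≫ X.2 ◁ 𝟙 (Y.2 ⊗ Z.2) ≫ 𝟙 _
        simp
      left_unitality := fun X => by
        change (λ_ X.2).hom = 𝟙 (𝟙_ D) ▷ X.2 ≫ 𝟙 _ ≫ (λ_ X.2).hom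
        simp
      right_unitality := fun X => by
        change (ρ_ X.2).hom = X.2 ◁ 𝟙 (𝟙_ D) ≫ 𝟙 _ ≫ (ρ_ X.2).hom
        simp }

instance sndBraided : (Prod.snd C D).Braided where
  braided _ _ := (Category.id_comp _).trans (Category.comp_id _).symm

/-- The monoid in a product of monoidal categories with given components. -/
def monMk {C : Type u₁} [Category.{v₁} C] [MonoidalCategory C]
    {D : Type u₂} [Category.{v₂} D] [MonoidalCategory D] (M : Mon C) (N : Mon D) : Mon (C × D) where
  X := (M.X, N.X)
  mon :=
    { one := (η[M.X], η[N.X])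
      mul := (μ[M.X], μ[N.X])
      one_mul := Prod.ext (MonObj.one_mul M.X) (MonObj.one_mul N.X)
      mul_one := Prod.ext (MonObj.mul_one M.X) (MonObj.mul_one N.X)
      mul_assoc := Prod.ext (MonObj.mul_assoc M.X) (MonObj.mul_assoc N.X) }

/-- The first component of `monMk M N` is `M`. -/
def fstMapMonMk (M : Mon C) (N : Mon D) : (Prod.fst C D).mapMon.obj (monMk M N) ≅ M :=
  Mon.mkIso (Iso.refl M.X)
    (by
      change (𝟙 (𝟙_ C) ≫ η[M.X]) ≫ 𝟙 M.X = η[M.X]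
      simp)
    (by
      change (𝟙 (M.X ⊗ M.X) ≫ μ[M.X]) ≫ 𝟙 M.X = (𝟙 M.X ⊗ₘ 𝟙 M.X) ≫ μ[M.X]
      simp)

/-- The second component of `monMk M N` is `N`. -/
def sndMapMonMk (M : Mon C) (N : Mon D) : (Prod.snd C D).mapMon.obj (monMk M N) ≅ N :=
  Mon.mkIso (Iso.refl N.X)
    (by
      change (𝟙 (𝟙_ D) ≫ η[N.X]) ≫ 𝟙 N.X = η[N.X]
      simp)
    (by
      change (𝟙 (N.X ⊗ N.X) ≫ μ[N.X]) ≫ 𝟙 N.X = (𝟙 N.X ⊗ₘ 𝟙 N.X) ≫ μ[N.X]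
      simp)

end CategoryTheory.Prod

/-! ### Central idempotents in a product, and functors inverting them -/

namespace TensorTopology

section

variable {C : Type u₁} [Category.{v₁} C] [MonoidalCategory C] [SymmetricCategory C]
  {D : Type u₂} [Category.{v₂} D] [MonoidalCategory D] [SymmetricCategory D]

namespace CentralIdempotent

/-- The identity of the tensor unit is a central idempotent. -/
def unit (C : Type u₁) [Category.{v₁} C] [MonoidalCategory C] [SymmetricCategory C] :
    CentralIdempotent C where
  dom := 𝟙_ C
  hom := 𝟙 (𝟙_ C)
  central := by simp [unitors_equal]
  isIso := by
    rw [whiskerLeft_id, Category.id_comp]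
    infer_instance

/-- If tensoring with the initial object yields an initial object, then the morphism from the
initial object to the tensor unit is a central idempotent. -/
def ofIsInitial {Z : C} (hZ : IsInitial Z) (hZZ : IsInitial (Z ⊗ Z)) : CentralIdempotent C where
  dom := Z
  hom := hZ.to (𝟙_ C)
  central := hZZ.hom_ext _ _
  isIso := ⟨hZ.to _, hZZ.hom_ext _ _, hZ.hom_ext _ _⟩

/-- A pair of central idempotents is a central idempotent in the product category. -/
def prod (u : CentralIdempotent C) (w : CentralIdempotent D) : CentralIdempotent (C × D) where
  dom := (u.dom, w.dom)
  hom := (u.hom, w.hom)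
  central := Prod.ext u.central w.central
  isIso :=
    ⟨(u.comul, w.comul), Prod.ext u.mul_comul w.mul_comul, Prod.ext u.comul_mul w.comul_mul⟩

variable (u : CentralIdempotent C) (P : C ⥤ D)

instance isIso_map_liftHom [P.Monoidal] [IsIso (P.map u.hom)] (A : C) :
    IsIso (P.map (u.liftHom (𝟙 A))) := by
  rw [liftHom, Functor.map_comp, Functor.Monoidal.map_whiskerLeft]
  infer_instance

/-- The case `g = 𝟙` of composition in the restriction gives back `f`. Applying `P` to that identity
and cancelling the invertible last factor determines the image of the part of the composite
preceding `g`. This makes `desc` functorial. -/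
lemma map_compHom {D : Type u₂} [Category.{v₂} D] (P : C ⥤ D) {A B E : C} (f : A ⊗ u.dom ⟶ B) (g : B ⊗ u.dom ⟶ E)
    [IsIso (P.map (u.liftHom (𝟙 B)))] :
    P.map (u.compHom f g) = P.map f ≫ inv (P.map (u.liftHom (𝟙 B))) ≫ P.map g := by
  have h := congrArg P.map (u.compHom_id f)
  simp only [compHom, Functor.map_comp] at h ⊢
  rw [← h]
  simp

end CentralIdempotent

/-! ### Factoring a braided functor through a restriction -/

namespace Restriction

variable {u : CentralIdempotent C} (P : C ⥤ D) [P.Braided] [IsIso (P.map u.hom)]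

open Functor.LaxMonoidal

variable (u) in
/-- A braided functor that inverts `u` factors through the restriction to `u`. -/
noncomputable def desc : Restriction u ⥤ D where
  obj A := P.obj A.as
  map {A _} f := inv (P.map (u.liftHom (𝟙 A.as))) ≫ P.map f.hom
  map_id A := IsIso.inv_hom_id (P.map (u.liftHom (𝟙 A.as)))
  map_comp f g := by
    change _ ≫ P.map (u.compHom f.hom g.hom) = _
    rw [u.map_compHom]
    simp

/-- The factorization is strict. Since the coherence morphisms of the restriction lie in the image
of `functor u`, those of `desc u P` reduce to the coherence of `P`. -/
lemma desc_map_functor_map {A B : C} (f : A ⟶ B) :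
    (desc u P).map ((functor u).map f) = P.map f := by
  change inv (P.map (u.liftHom (𝟙 A))) ≫ P.map (u.liftHom f) = P.map f
  rw [IsIso.inv_comp_eq, ← P.map_comp]
  simp [CentralIdempotent.liftHom]

/-- Restricted tensor products all begin with the same morphism, comultiplication followed by the
middle interchange, independent of `f` and `f'`. The identity of `A ⊗ A'` is itself such a product,
so this prefix cancels under `P` and naturality of `μ P` remains. -/
lemma μ_desc_map_tensorHom {A B A' B' : Restriction u} (f : A ⟶ B) (f' : A' ⟶ B') :
    ((desc u P).map f ⊗ₘ (desc u P).map f') ≫ μ P B.as B'.as =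
      μ P A.as A'.as ≫ (desc u P).map (f ⊗ₘ f') := by
  have h : P.map (u.liftHom (𝟙 (A.as ⊗ A'.as))) = P.map ((A.as ⊗ A'.as) ◁ u.comul ≫
      tensorμ A.as A'.as u.dom u.dom) ≫
      P.map (u.liftHom (𝟙 A.as) ⊗ₘ u.liftHom (𝟙 A'.as)) := by
    rw [← P.map_comp, Category.assoc, ← id_tensorHom_id, ← u.lift_tensHom_lift]
    rfl
  have h' : P.map (u.tensHom f.hom f'.hom) = P.map ((A.as ⊗ A'.as) ◁ u.comul ≫
      tensorμ A.as A'.as u.dom u.dom) ≫ P.map (f.hom ⊗ₘ f'.hom) := by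
    rw [← P.map_comp, Category.assoc]
    rfl
  have hi : IsIso (P.map (u.liftHom (𝟙 A.as) ⊗ₘ u.liftHom (𝟙 A'.as))) := by
    rw [Functor.Monoidal.map_tensor]
    infer_instance
  -- Two out of three in `h`: the left side and the last factor are invertible, hence so is the
  -- common prefix.
  have hk : IsIso (P.map ((A.as ⊗ A'.as) ◁ u.comul ≫ tensorμ A.as A'.as u.dom u.dom)) := by
    have : IsIso (P.map ((A.as ⊗ A'.as) ◁ u.comul ≫ tensorμ A.as A'.as u.dom u.dom) ≫
      P.map (u.liftHom (𝟙 A.as) ⊗ₘ u.liftHom (𝟙 A'.as))) := h ▸ inferInstance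
    exact IsIso.of_isIso_comp_right _ (P.map (u.liftHom (𝟙 A.as) ⊗ₘ u.liftHom (𝟙 A'.as)))
  have e : (desc u P).map (f ⊗ₘ f') =
      inv (P.map (u.liftHom (𝟙 A.as) ⊗ₘ u.liftHom (𝟙 A'.as))) ≫ P.map (f.hom ⊗ₘ f'.hom) := by
    change inv (P.map (u.liftHom (𝟙 (A.as ⊗ A'.as)))) ≫ P.map (u.tensHom f.hom f'.hom) = _
    rw [IsIso.inv_comp_eq, h, h']
    simp
  -- Naturality of `μ P` at the two identities of the restriction, with the images of these
  -- inverted.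
  have e' : μ P A.as A'.as ≫ inv (P.map (u.liftHom (𝟙 A.as) ⊗ₘ u.liftHom (𝟙 A'.as))) =
      (inv (P.map (u.liftHom (𝟙 A.as))) ⊗ₘ inv (P.map (u.liftHom (𝟙 A'.as)))) ≫ μ P _ _ := by
    rw [IsIso.comp_inv_eq, Category.assoc, ← μ_natural, tensorHom_comp_tensorHom_assoc]
    simp
  refine Eq.trans ?_ (congrArg (fun k => μ P A.as A'.as ≫ k) e).symm
  change ((inv (P.map (u.liftHom (𝟙 A.as))) ≫ P.map f.hom) ⊗ₘ
    (inv (P.map (u.liftHom (𝟙 A'.as))) ≫ P.map f'.hom)) ≫ μ P B.as B'.as = μ P A.as A'.as ≫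
      inv (P.map (u.liftHom (𝟙 A.as) ⊗ₘ u.liftHom (𝟙 A'.as))) ≫ P.map (f.hom ⊗ₘ f'.hom)
  rw [reassoc_of% e', ← μ_natural, tensorHom_comp_tensorHom_assoc]

/-- The structure morphisms are those of `P`. Only their naturality against the larger hom-sets is
new; whiskerings are treated as tensor products with identities. -/
noncomputable instance : (desc u P).Monoidal :=
  Functor.CoreMonoidal.toMonoidal
    { εIso := Functor.Monoidal.εIso P
      μIso := fun A B => Functor.Monoidal.μIso P A.as B.as
      μIso_hom_natural_left := fun f X =>
        (congrArg (fun k => k ≫ μ P _ _)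
          ((congrArg (fun k => (desc u P).map f ⊗ₘ k) ((desc u P).map_id X)).trans
            (tensorHom_id _ _))).symm.trans (μ_desc_map_tensorHom P f (𝟙 X))
      μIso_hom_natural_right := fun X f =>
        (congrArg (fun k => k ≫ μ P _ _)
          ((congrArg (fun k => k ⊗ₘ (desc u P).map f) ((desc u P).map_id X)).trans
            (id_tensorHom _ _))).symm.trans (μ_desc_map_tensorHom P (𝟙 X) f)
      associativity := fun X Y Z =>
        (congrArg (fun k => μ P X.as Y.as ▷ P.obj Z.as ≫ μ P (X.as ⊗ Y.as) Z.as ≫ k)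
          (desc_map_functor_map P (α_ X.as Y.as Z.as).hom)).trans
          (associativity P X.as Y.as Z.as)
      left_unitality := fun X =>
        (left_unitality P X.as).trans
          (congrArg (fun k => ε P ▷ P.obj X.as ≫ μ P (𝟙_ C) X.as ≫ k)
            (desc_map_functor_map P (λ_ X.as).hom).symm)
      right_unitality := fun X =>
        (right_unitality P X.as).trans
          (congrArg (fun k => P.obj X.as ◁ ε P ≫ μ P X.as (𝟙_ C) ≫ k)
            (desc_map_functor_map P (ρ_ X.as).hom).symm) }

noncomputable instance : (desc u P).Braided where
  braided X Y :=
    (congrArg (fun k => μ P X.as Y.as ≫ k) (desc_map_functor_map P (β_ X.as Y.as).hom)).trans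
      (Functor.LaxBraided.braided (F := P) X.as Y.as)

/-- Restricting a monoid to `u` and then applying the induced functor amounts to applying the
original functor. -/
noncomputable def descMapMonIso (M : Mon C) :
    (desc u P).mapMon.obj ((functor u).mapMon.obj M) ≅ P.mapMon.obj M :=
  Mon.mkIso (Iso.refl (P.obj M.X))
    -- The unit of the restricted monoid is that of `M` preceded by an identity structure morphism
    -- of `functor u`; removing it leaves the image of a morphism of `C`. The multiplication is
    -- treated in the same way.
    ((Category.comp_id _).trans (congrArg (fun k => ε P ≫ k)
      ((congrArg (desc u P).map (Category.id_comp _)).trans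
        (desc_map_functor_map P (MonObj.one (X := M.X))))))
    ((Category.comp_id _).trans ((congrArg (fun k => μ P M.X M.X ≫ k)
      ((congrArg (desc u P).map (Category.id_comp _)).trans
        (desc_map_functor_map P (MonObj.mul (X := M.X))))).trans
          ((Category.id_comp _).symm.trans
            (congrArg (fun k => k ≫ μ P M.X M.X ≫ P.map MonObj.mul) (id_tensorHom_id _ _).symm))))

/-- On morphisms, `desc u P` is `P` followed by precomposition with an isomorphism, so it is
bijective exactly when `P` is; on objects it agrees with `P`. -/
lemma desc_isEquivalence [P.EssSurj]
    (h : ∀ A B : C, Function.Bijective (fun f : A ⊗ u.dom ⟶ B => P.map f)) :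
    (desc u P).IsEquivalence where
  faithful := ⟨fun {A B} f g e => Hom.ext ((h A.as B.as).1
    ((cancel_epi (inv (P.map (u.liftHom (𝟙 A.as))))).1 e))⟩
  full := ⟨fun {A B} g => by
    obtain ⟨f, hf⟩ := (h A.as B.as).2 (P.map (u.liftHom (𝟙 A.as)) ≫ g)
    exact ⟨⟨f⟩, (IsIso.inv_comp_eq _).2 hf⟩⟩
  essSurj := ⟨fun Y => ⟨⟨P.objPreimage Y⟩, ⟨P.objObjPreimageIso Y⟩⟩⟩

end Restriction

end

end TensorTopology

/-! ### The two idempotents of the product and their restrictions -/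

theorem mainTheorem11
    {C₁ : Type u₁} [Category.{v₁} C₁] [MonoidalCategory C₁] [SymmetricCategory C₁]
    {C₂ : Type u₂} [Category.{v₂} C₂] [MonoidalCategory C₂] [SymmetricCategory C₂]
    [HasInitial C₁] (h₁ : ∀ A : C₁, Nonempty (A ⊗ (⊥_ C₁) ≅ ⊥_ C₁))
    [HasInitial C₂] (h₂ : ∀ A : C₂, Nonempty (A ⊗ (⊥_ C₂) ≅ ⊥_ C₂))
    (M₁ : Mon C₁) (M₂ : Mon C₂) :
    ∃ (C : Type (max u₁ u₂)) (_ : Category.{max v₁ v₂} C) (_ : MonoidalCategory C)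
      (_ : SymmetricCategory C) (M : Mon C) (w₁ w₂ : TensorTopology.CentralIdempotent C),
      (∃ (F : TensorTopology.Restriction w₁ ⥤ C₁) (_ : F.Braided), F.IsEquivalence ∧
        Nonempty (F.mapMon.obj ((TensorTopology.Restriction.functor w₁).mapMon.obj M) ≅ M₁)) ∧
      (∃ (F : TensorTopology.Restriction w₂ ⥤ C₂) (_ : F.Braided), F.IsEquivalence ∧
        Nonempty (F.mapMon.obj ((TensorTopology.Restriction.functor w₂).mapMon.obj M) ≅ M₂)) := by
  let i₁ : ∀ A : C₁, IsInitial (A ⊗ ⊥_ C₁) := fun A => initialIsInitial.ofIso (h₁ A).some.symm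
  let i₂ : ∀ A : C₂, IsInitial (A ⊗ ⊥_ C₂) := fun A => initialIsInitial.ofIso (h₂ A).some.symm
  let w₁ := (TensorTopology.CentralIdempotent.unit C₁).prod
    (TensorTopology.CentralIdempotent.ofIsInitial initialIsInitial (i₂ (⊥_ C₂)))
  let w₂ := (TensorTopology.CentralIdempotent.ofIsInitial initialIsInitial (i₁ (⊥_ C₁))).prod
    (TensorTopology.CentralIdempotent.unit C₂)
  have : IsIso ((CategoryTheory.Prod.fst C₁ C₂).map w₁.hom) := inferInstanceAs (IsIso (𝟙 (𝟙_ C₁)))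
  have : IsIso ((CategoryTheory.Prod.snd C₁ C₂).map w₂.hom) := inferInstanceAs (IsIso (𝟙 (𝟙_ C₂)))
  -- The unit is only a filler: any object of the other factor would serve.
  have : (CategoryTheory.Prod.fst C₁ C₂).EssSurj := ⟨fun X => ⟨(X, 𝟙_ C₂), ⟨Iso.refl X⟩⟩⟩
  have : (CategoryTheory.Prod.snd C₁ C₂).EssSurj := ⟨fun Y => ⟨(𝟙_ C₁, Y), ⟨Iso.refl Y⟩⟩⟩
  refine ⟨C₁ × C₂, inferInstance, inferInstance, inferInstance, CategoryTheory.Prod.monMk M₁ M₂, w₁, w₂,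
    ⟨TensorTopology.Restriction.desc w₁ (CategoryTheory.Prod.fst C₁ C₂), inferInstance,
      TensorTopology.Restriction.desc_isEquivalence _ fun A B => ⟨fun f g e => ?_, fun g => ?_⟩,
      ⟨TensorTopology.Restriction.descMapMonIso _ _ ≪≫ CategoryTheory.Prod.fstMapMonMk C₁ C₂ M₁ M₂⟩⟩,
    ⟨TensorTopology.Restriction.desc w₂ (CategoryTheory.Prod.snd C₁ C₂), inferInstance,
      TensorTopology.Restriction.desc_isEquivalence _ fun A B => ⟨fun f g e => ?_, fun g => ?_⟩,
      ⟨TensorTopology.Restriction.descMapMonIso _ _ ≪≫ CategoryTheory.Prod.sndMapMonMk C₁ C₂ M₁ M₂⟩⟩⟩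
  -- `e` is equality of first components; second components have domain `A.2 ⊗ 0`, so they agree,
  -- and in the next goal the one required exists, by initiality. The goals for `w₂` are symmetric.
  · exact Prod.ext e ((i₂ A.2).hom_ext _ _)
  · exact ⟨(g, (i₂ A.2).to B.2), rfl⟩
  · exact Prod.ext ((i₁ A.1).hom_ext _ _) e
  · exact ⟨((i₁ A.1).to B.1, g), rfl⟩
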